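/- Let $X$ be a complex Banach space with dual space $X'$, and let $(e^{tA})_{t\ge 0}$ be a $C_0$-semigroup on $X$ with generator $A$. Let $E\subset X'$ be a vector subspace which is closed in the norm topology and almost norming, i.e. there is a constant $C>0$ such that $$\|x\|\le \sup_{x'\in E,\ \|x'\|\le 1} C\,|\langle x',x\rangle|\qquad\text{for all }x\in X.$$ Suppose that for each $x\in X$ and each $x'\in E$ there is some $p\in[1,\infty)$ (which may depend on $x$ and $x'$) such that $$\int_0^\infty |\langle x',e^{tA}x\rangle|^p\,dt<\infty .$$ Let $s_0(A)\in[-\infty,\infty]$ denote the abscissa of uniform boundedness of the resolvent of $A$, i.e. the infimum of all real numbers $s$ such that the half-plane $\{z\in\mathbb{C}:\operatorname{Re}z\ge s\}$ is contained in the resolvent set of $A$ and the resolvent $R(z,A)=(z-A)^{-1}$ is bounded in operator norm, uniformly in $z$, on this half-plane. Then $s_0(A)<0$. -/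

import Mathlib

open Filter Topology MeasureTheory

/-- A `C₀`-semigroup (strongly continuous one-parameter operator semigroup) on `X`. The time
parameter is a real number `t`; only the values at `t ≥ 0` are meaningful. -/
structure C0Semigroup (X : Type*) [NormedAddCommGroup X] [NormedSpace ℂ X] where
  toFun : ℝ → X →L[ℂ] X
  map_zero' : toFun 0 = ContinuousLinearMap.id ℂ X
  map_add' : ∀ s t : ℝ, 0 ≤ s → 0 ≤ t → toFun (s + t) = (toFun s).comp (toFun t)
  continuousOn' : ∀ x : X, ContinuousOn (fun t : ℝ => toFun t x) (Set.Ici 0)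

namespace C0Semigroup

variable {X : Type*} [NormedAddCommGroup X] [NormedSpace ℂ X]

instance : CoeFun (C0Semigroup X) (fun _ => ℝ → X →L[ℂ] X) := ⟨C0Semigroup.toFun⟩

/-- The difference quotients `(T t x - x) / t` converge to `y` in norm as `t ↓ 0`. -/
def HasRightDerivZero (T : C0Semigroup X) (x y : X) : Prop :=
  Tendsto (fun t : ℝ => (t⁻¹ : ℝ) • (T t x - x)) (𝓝[>] 0) (𝓝 y)

theorem HasRightDerivZero.unique {T : C0Semigroup X} {x y z : X}
    (hy : T.HasRightDerivZero x y) (hz : T.HasRightDerivZero x z) : y = z :=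
  tendsto_nhds_unique hy hz

theorem HasRightDerivZero.add {T : C0Semigroup X} {x₁ x₂ y₁ y₂ : X}
    (h₁ : T.HasRightDerivZero x₁ y₁) (h₂ : T.HasRightDerivZero x₂ y₂) :
    T.HasRightDerivZero (x₁ + x₂) (y₁ + y₂) := by
  refine (Tendsto.add h₁ h₂).congr fun t => ?_
  rw [← smul_add, map_add]
  congr 1
  abel

theorem HasRightDerivZero.smul {T : C0Semigroup X} {x y : X} (c : ℂ)
    (h : T.HasRightDerivZero x y) : T.HasRightDerivZero (c • x) (c • y) := by
  refine (Tendsto.const_smul h c).congr fun t => ?_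
  rw [map_smul, ← smul_sub, smul_comm]

theorem HasRightDerivZero.zero (T : C0Semigroup X) : T.HasRightDerivZero 0 0 := by
  simp [HasRightDerivZero]

/-- The domain of the generator: all `x` for which `lim_{t ↓ 0} (T t x - x) / t` exists. -/
def generatorDomain (T : C0Semigroup X) : Submodule ℂ X where
  carrier := {x | ∃ y, T.HasRightDerivZero x y}
  add_mem' := by
    rintro _ _ ⟨y₁, h₁⟩ ⟨y₂, h₂⟩
    exact ⟨y₁ + y₂, h₁.add h₂⟩
  zero_mem' := ⟨0, HasRightDerivZero.zero T⟩
  smul_mem' := by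
    rintro c _ ⟨y, h⟩
    exact ⟨c • y, h.smul c⟩

/-- The generator `A` of the semigroup, an unbounded operator on `X`:
`A x = lim_{t ↓ 0} (T t x - x) / t`, on the domain of all `x` for which the limit exists. -/
noncomputable def generator (T : C0Semigroup X) : X →ₗ.[ℂ] X where
  domain := T.generatorDomain
  toFun :=
    { toFun := fun x => Classical.choose x.2
      map_add' := fun x y =>
        (Classical.choose_spec (x + y).2).unique
          ((Classical.choose_spec x.2).add (Classical.choose_spec y.2))
      map_smul' := fun c x =>
        (Classical.choose_spec (c • x).2).unique ((Classical.choose_spec x.2).smul c) }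

theorem generator_spec (T : C0Semigroup X) (x : T.generator.domain) :
    T.HasRightDerivZero x (T.generator x) :=
  Classical.choose_spec x.2

end C0Semigroup

namespace UnboundedOperator

variable {X : Type*} [NormedAddCommGroup X] [NormedSpace ℂ X]

/-- The bounded operator `R` on `X` is a two-sided inverse of `z - A : D(A) → X`. -/
def IsResolventAt (A : X →ₗ.[ℂ] X) (z : ℂ) (R : X →L[ℂ] X) : Prop :=
  (∀ x : A.domain, R (z • (x : X) - A x) = x) ∧
    ∀ y : X, ∃ h : R y ∈ A.domain, z • R y - A ⟨R y, h⟩ = y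

/-- The resolvent set of `A`: all `z` such that `z - A : D(A) → X` is bijective with bounded
inverse. -/
def resolventSet (A : X →ₗ.[ℂ] X) : Set ℂ :=
  {z | ∃ R : X →L[ℂ] X, IsResolventAt A z R}

theorem IsResolventAt.unique {A : X →ₗ.[ℂ] X} {z : ℂ} {R S : X →L[ℂ] X}
    (hR : IsResolventAt A z R) (hS : IsResolventAt A z S) : R = S := by
  ext y
  obtain ⟨h, hy⟩ := hS.2 y
  have := hR.1 ⟨S y, h⟩
  rwa [hy] at this

open Classical in
/-- The resolvent `R(z, A) = (z - A)⁻¹` of `A` at a point `z` of the resolvent set (and the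
meaningless value `0` elsewhere). -/
noncomputable def resolvent (A : X →ₗ.[ℂ] X) (z : ℂ) : X →L[ℂ] X :=
  if h : z ∈ resolventSet A then Classical.choose h else 0

theorem isResolventAt_resolvent {A : X →ₗ.[ℂ] X} {z : ℂ} (h : z ∈ resolventSet A) :
    IsResolventAt A z (resolvent A z) := by
  rw [resolvent, dif_pos h]
  exact Classical.choose_spec h

/-- The abscissa of uniform boundedness `s₀(A)` of the resolvent of `A`: the infimum, in the
extended reals, of all real `s` such that the half-plane `{z | s ≤ Re z}` is contained in the
resolvent set and the resolvent is uniformly bounded on it. -/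
noncomputable def abscissaUniformBoundedness (A : X →ₗ.[ℂ] X) : EReal :=
  sInf ((fun s : ℝ => (s : EReal)) ''
    {s : ℝ | {z : ℂ | s ≤ z.re} ⊆ resolventSet A ∧
      ∃ M : ℝ, ∀ z : ℂ, s ≤ z.re → ‖resolvent A z‖ ≤ M})

end UnboundedOperator

/-- A subspace `E` of the dual space is almost norming if, for some constant `C > 0`,
`‖x‖ ≤ sup {C * |⟨x', x⟩| : x' ∈ E, ‖x'‖ ≤ 1}` for all `x`. (The supremum is over a nonempty
set that is bounded above by `C * ‖x‖`.) -/
def IsAlmostNorming {X : Type*} [NormedAddCommGroup X] [NormedSpace ℂ X]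
    (E : Submodule ℂ (StrongDual ℂ X)) : Prop :=
  ∃ C : ℝ, 0 < C ∧ ∀ x : X,
    ‖x‖ ≤ sSup ((fun x' : StrongDual ℂ X => C * ‖x' x‖) '' {x' | x' ∈ E ∧ ‖x'‖ ≤ 1})

/-! Weak integrability is used only through the excess `∫ (|⟨x', T(t)x⟩| - δ)₊ dt`, which is finite
for every `δ > 0` whatever the exponent `p`. Baire's theorem on `X × E` makes it uniform: for each
`ε > 0` there is `K` bounding the `ε`-excess over both unit balls (`exists_excess_bound`).

For `Re z > 0`, splitting `|⟨x', T(t)x⟩|` into its excess over `ε` and a remainder at most `ε`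
bounds all truncated Laplace transforms, tested against `x'`, by `K + ε / Re z`. Since `E` is almost
norming, these transforms are bounded in norm by `C (K + ε / Re z)`. They converge to the resolvent,
which inherits the bound; no growth bound for the semigroup is needed.

The gain is that `ε` is arbitrary. If `C ε` is small, then near the imaginary axis `‖R(z, A)‖` is at
most a small multiple of `1 / Re z`, so the Neumann series around `σ + iη`, for one small `σ`,
reaches past the axis uniformly in `η`. -/

namespace C0Semigroup

variable {X : Type*} [NormedAddCommGroup X] [NormedSpace ℂ X]

/-! ### Rescaled semigroups -/

theorem zero_apply (T : C0Semigroup X) (x : X) : T 0 x = x := by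
  rw [T.map_zero']; rfl

theorem add_apply (T : C0Semigroup X) {s t : ℝ} (hs : 0 ≤ s) (ht : 0 ≤ t) (x : X) :
    T (s + t) x = T s (T t x) := by
  rw [T.map_add' s t hs ht]; rfl

/-- The rescaled semigroup `t ↦ e^{-zt} T(t)`. -/
noncomputable def rescale (T : C0Semigroup X) (z : ℂ) : C0Semigroup X where
  toFun t := Complex.exp (-(z * t)) • T t
  map_zero' := by simp [T.map_zero']
  map_add' s t hs ht := by
    rw [T.map_add' s t hs ht]
    ext x
    simp only [smul_apply, ContinuousLinearMap.comp_apply, map_smul, smul_smul,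
      ← Complex.exp_add]
    push_cast
    ring_nf
  continuousOn' x := by
    have h : Continuous fun t : ℝ => Complex.exp (-(z * t)) := by fun_prop
    exact h.continuousOn.smul (T.continuousOn' x)

theorem rescale_apply (T : C0Semigroup X) (z : ℂ) (t : ℝ) (x : X) :
    T.rescale z t x = Complex.exp (-(z * t)) • T t x := rfl

theorem norm_rescale_apply (T : C0Semigroup X) (z : ℂ) (t : ℝ) (x : X) :
    ‖T.rescale z t x‖ = Real.exp (-z.re * t) * ‖T t x‖ := by
  rw [rescale_apply, norm_smul, Complex.norm_exp]
  simp

/-- Product rule at `0` for `e^{-zt} T(t)x`, and for its inverse rescaling. It reduces inverting `z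
- A` to inverting the negative of a generator. -/
theorem hasRightDerivZero_rescale_iff (T : C0Semigroup X) (z : ℂ) {x y : X} :
    (T.rescale z).HasRightDerivZero x (y - z • x) ↔ T.HasRightDerivZero x y := by
  have hexp (w : ℂ) : Tendsto (fun t : ℝ => t⁻¹ • (Complex.exp (w * t) - 1)) (𝓝[>] 0) (𝓝 w) := by
    have h : HasDerivAt (fun t : ℝ => Complex.exp (w * t)) w 0 := by
      have := (((hasDerivAt_id (0 : ℂ)).const_mul w).cexp).comp_ofReal (z := 0)
      simpa using this
    simpa using h.tendsto_slope_zero_right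
  have hone (w : ℂ) : Tendsto (fun t : ℝ => Complex.exp (w * t)) (𝓝[>] 0) (𝓝 1) := by
    have h : Continuous fun t : ℝ => Complex.exp (w * t) := by fun_prop
    simpa using (h.tendsto 0).mono_left nhdsWithin_le_nhds
  constructor
  · intro h
    have := ((hone z).smul h).add ((hexp z).smul_const x)
    rw [one_smul, sub_add_cancel] at this
    refine this.congr fun t => ?_
    simp only [rescale_apply]
    rw [smul_comm, smul_assoc, ← smul_add, smul_sub, smul_smul, ← Complex.exp_add, sub_smul,
      add_neg_cancel, Complex.exp_zero, one_smul, one_smul]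
    congr 1
    abel
  · intro h
    have := ((hone (-z)).smul h).add ((hexp (-z)).smul_const x)
    rw [one_smul, neg_smul, ← sub_eq_add_neg] at this
    refine this.congr fun t => ?_
    simp only [rescale_apply]
    rw [smul_comm, smul_assoc, ← smul_add, smul_sub, sub_smul, one_smul, neg_mul]
    congr 1
    abel

/-! ### Orbit integrals and the generator -/

theorem HasRightDerivZero.generator_eq {T : C0Semigroup X} {x y : X}
    (h : T.HasRightDerivZero x y) : T.generator ⟨x, y, h⟩ = y :=
  (T.generator_spec ⟨x, y, h⟩).unique h

theorem intervalIntegrable_orbit (T : C0Semigroup X) (x : X) {a b : ℝ} (ha : 0 ≤ a) (hb : 0 ≤ b) :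
    IntervalIntegrable (fun t => T t x) volume a b :=
  ((T.continuousOn' x).mono fun _ ht => (le_min ha hb).trans ht.1).intervalIntegrable

/-- The integral `∫₀^τ T(t)x dt` of an orbit. -/
noncomputable def orbitIntegral (T : C0Semigroup X) (τ : ℝ) (x : X) : X := ∫ t in (0)..τ, T t x

theorem orbitIntegral_add (T : C0Semigroup X) {τ : ℝ} (hτ : 0 ≤ τ) (x y : X) :
    T.orbitIntegral τ (x + y) = T.orbitIntegral τ x + T.orbitIntegral τ y := by
  simp only [orbitIntegral, map_add]
  exact intervalIntegral.integral_add (T.intervalIntegrable_orbit x le_rfl hτ)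
    (T.intervalIntegrable_orbit y le_rfl hτ)

theorem orbitIntegral_smul (T : C0Semigroup X) (τ : ℝ) (c : ℂ) (x : X) :
    T.orbitIntegral τ (c • x) = c • T.orbitIntegral τ x := by
  simp only [orbitIntegral, map_smul]
  exact intervalIntegral.integral_smul c _

theorem orbitIntegral_sub (T : C0Semigroup X) {τ : ℝ} (hτ : 0 ≤ τ) (x y : X) :
    T.orbitIntegral τ (x - y) = T.orbitIntegral τ x - T.orbitIntegral τ y := by
  rw [eq_sub_iff_add_eq, ← T.orbitIntegral_add hτ, sub_add_cancel]

section Complete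

variable [CompleteSpace X]

/-- By the semigroup law, `T t` translates the window of integration. -/
theorem map_orbitIntegral (T : C0Semigroup X) {t τ : ℝ} (ht : 0 ≤ t) (hτ : 0 ≤ τ) (x : X) :
    T t (T.orbitIntegral τ x) = T.orbitIntegral (τ + t) x - T.orbitIntegral t x := by
  rw [orbitIntegral, ← (T t).intervalIntegral_comp_comm (T.intervalIntegrable_orbit x le_rfl hτ)]
  have : ∫ s in (0)..τ, T t (T s x) = ∫ s in (0)..τ, T (s + t) x := by
    refine intervalIntegral.integral_congr fun s hs => ?_
    rw [Set.uIcc_of_le hτ] at hs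
    rw [add_comm, T.add_apply ht hs.1]
  rw [this, intervalIntegral.integral_comp_add_right (fun s => T s x), zero_add, orbitIntegral,
    orbitIntegral, intervalIntegral.integral_interval_sub_left
      (T.intervalIntegrable_orbit x le_rfl (add_nonneg hτ ht))
      (T.intervalIntegrable_orbit x le_rfl ht)]

theorem tendsto_smul_orbitIntegral_sub (T : C0Semigroup X) {τ : ℝ} (hτ : 0 ≤ τ) (x : X) :
    Tendsto (fun t : ℝ => t⁻¹ • (T.orbitIntegral (τ + t) x - T.orbitIntegral τ x)) (𝓝[>] 0)
      (𝓝 (T τ x)) := by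
  have hc : ContinuousOn (fun t => T t x) (Set.Ioi τ) :=
    (T.continuousOn' x).mono fun t ht => hτ.trans (le_of_lt ht)
  have h : HasDerivWithinAt (fun u => T.orbitIntegral u x) (T τ x) (Set.Ioi τ) τ := by
    refine HasDerivWithinAt.mono ?_ Set.Ioi_subset_Ici_self
    refine intervalIntegral.integral_hasDerivWithinAt_right (t := Set.Ioi τ)
      (T.intervalIntegrable_orbit x le_rfl hτ) ?_
      ((T.continuousOn' x τ hτ).mono fun t ht => hτ.trans (le_of_lt ht))
    exact hc.stronglyMeasurableAtFilter_nhdsWithin measurableSet_Ioi τ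
  have h0 : Tendsto (fun t : ℝ => τ + t) (𝓝[>] 0) (𝓝[>] τ) := by
    refine tendsto_nhdsWithin_of_tendsto_nhds_of_eventually_within _ ?_ ?_
    · have : Tendsto (fun t : ℝ => τ + t) (𝓝 0) (𝓝 (τ + 0)) := tendsto_id.const_add τ
      rw [add_zero] at this
      exact this.mono_left nhdsWithin_le_nhds
    · filter_upwards [self_mem_nhdsWithin] with t ht
      exact lt_add_of_pos_right τ ht
  rw [hasDerivWithinAt_iff_tendsto_slope' (by simp)] at h
  refine (h.comp h0).congr fun t => ?_
  simp [slope]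

theorem tendsto_smul_orbitIntegral (T : C0Semigroup X) (x : X) :
    Tendsto (fun t : ℝ => t⁻¹ • T.orbitIntegral t x) (𝓝[>] 0) (𝓝 x) := by
  have := T.tendsto_smul_orbitIntegral_sub le_rfl x
  simpa [zero_apply, orbitIntegral] using this

theorem hasRightDerivZero_orbitIntegral (T : C0Semigroup X) {τ : ℝ} (hτ : 0 ≤ τ) (x : X) :
    T.HasRightDerivZero (T.orbitIntegral τ x) (T τ x - x) := by
  refine ((T.tendsto_smul_orbitIntegral_sub hτ x).sub (T.tendsto_smul_orbitIntegral x)).congr' ?_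
  filter_upwards [self_mem_nhdsWithin] with t ht
  rw [T.map_orbitIntegral (le_of_lt ht) hτ, ← smul_sub]
  congr 1
  abel

/-- The averages `t⁻¹ ∫₀ᵗ T(s)x ds` lie in the domain and tend to `x` as `t ↓ 0`. -/
theorem dense_generatorDomain (T : C0Semigroup X) : Dense (T.generatorDomain : Set X) := by
  intro x
  refine mem_closure_of_tendsto (T.tendsto_smul_orbitIntegral x) ?_
  filter_upwards [self_mem_nhdsWithin] with t ht
  have h := T.generatorDomain.smul_mem ((t⁻¹ : ℝ) : ℂ)
    (show T.orbitIntegral t x ∈ T.generatorDomain from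
      ⟨_, T.hasRightDerivZero_orbitIntegral (le_of_lt ht) x⟩)
  rwa [Complex.coe_smul] at h

theorem orbitIntegral_of_hasRightDerivZero {T : C0Semigroup X} {x y : X}
    (h : T.HasRightDerivZero x y) {τ : ℝ} (hτ : 0 ≤ τ) : T.orbitIntegral τ y = T τ x - x := by
  have hd : ∀ t ∈ Set.Ioo (min 0 τ) (max 0 τ),
      HasDerivWithinAt (fun t => T t x) (T t y) (Set.Ioi t) t := by
    intro t ht
    rw [min_eq_left hτ, max_eq_right hτ] at ht
    have h0 : Tendsto (fun s : ℝ => s - t) (𝓝[>] t) (𝓝[>] 0) := by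
      refine tendsto_nhdsWithin_of_tendsto_nhds_of_eventually_within _ ?_ ?_
      · have : Tendsto (fun s : ℝ => s - t) (𝓝 t) (𝓝 (t - t)) := tendsto_id.sub_const t
        rw [sub_self] at this
        exact this.mono_left nhdsWithin_le_nhds
      · filter_upwards [self_mem_nhdsWithin] with s hs
        exact sub_pos.2 (Set.mem_Ioi.1 hs)
    rw [hasDerivWithinAt_iff_tendsto_slope' (by simp)]
    refine (((T t).continuous.tendsto y).comp (h.comp h0)).congr' ?_
    filter_upwards [self_mem_nhdsWithin] with s hs
    have hs' : t ≤ s := le_of_lt hs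
    simp only [Function.comp_apply, slope, vsub_eq_sub]
    rw [ContinuousLinearMap.map_smul_of_tower, map_sub, ← T.add_apply ht.1.le (sub_nonneg.2 hs'),
      add_sub_cancel]
  have := intervalIntegral.integral_eq_sub_of_hasDeriv_right (f := fun t => T t x)
    ((T.continuousOn' x).mono fun t ht => (le_min le_rfl hτ).trans ht.1) hd
    (T.intervalIntegrable_orbit y le_rfl hτ)
  rw [orbitIntegral, this, zero_apply]

/-! ### From bounded orbit integrals to the resolvent -/

/-- Uniform boundedness carries convergence from the dense domain to all of `X`. -/
theorem exists_tendsto_orbitIntegral (T : C0Semigroup X) {M : ℝ}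
    (hM : ∀ τ, 0 ≤ τ → ∀ x, ‖T.orbitIntegral τ x‖ ≤ M * ‖x‖)
    (hD : ∀ x ∈ T.generatorDomain, ∃ y, Tendsto (fun τ => T.orbitIntegral τ x) atTop (𝓝 y))
    (x : X) : ∃ y, Tendsto (fun τ => T.orbitIntegral τ x) atTop (𝓝 y) := by
  refine cauchy_map_iff_exists_tendsto.1 (Metric.cauchySeq_iff'.2 fun ε hε => ?_ :
    CauchySeq fun τ => T.orbitIntegral τ x)
  have hM0 : 0 < |M| + 1 := by positivity
  obtain ⟨d, hd, hxd⟩ := Metric.dense_iff.1 T.dense_generatorDomain x (ε / (4 * (|M| + 1)))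
    (by positivity)
  obtain ⟨y, hy⟩ := hD d hxd
  have key : ∀ τ, 0 ≤ τ → ‖T.orbitIntegral τ x - T.orbitIntegral τ d‖ ≤ ε / 4 := by
    intro τ hτ
    rw [← T.orbitIntegral_sub hτ]
    have h2 : ‖x - d‖ < ε / (4 * (|M| + 1)) := by rw [← dist_eq_norm, dist_comm]; exact hd
    calc _ ≤ M * ‖x - d‖ := hM τ hτ _
      _ ≤ (|M| + 1) * (ε / (4 * (|M| + 1))) := by
        gcongr
        linarith [le_abs_self M]
      _ = ε / 4 := by field_simp
  obtain ⟨N', hN'⟩ := Metric.cauchySeq_iff.1 hy.cauchySeq (ε / 2) (by positivity)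
  refine ⟨max N' 0, fun n hn => ?_⟩
  have h1 := key n ((le_max_right _ _).trans hn)
  have h2 := key (max N' 0) (le_max_right _ _)
  have h3 := hN' n ((le_max_left _ _).trans hn) (max N' 0) (le_max_left _ _)
  rw [dist_eq_norm] at h3 ⊢
  have : T.orbitIntegral n x - T.orbitIntegral (max N' 0) x =
      (T.orbitIntegral n x - T.orbitIntegral n d) +
      (T.orbitIntegral n d - T.orbitIntegral (max N' 0) d) -
      (T.orbitIntegral (max N' 0) x - T.orbitIntegral (max N' 0) d) := by abel
  rw [this]
  have := norm_sub_le ((T.orbitIntegral n x - T.orbitIntegral n d) +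
      (T.orbitIntegral n d - T.orbitIntegral (max N' 0) d))
      (T.orbitIntegral (max N' 0) x - T.orbitIntegral (max N' 0) d)
  have := norm_add_le (T.orbitIntegral n x - T.orbitIntegral n d)
      (T.orbitIntegral n d - T.orbitIntegral (max N' 0) d)
  linarith

/-- If the orbit integrals of a semigroup converge pointwise and are uniformly bounded, then their
limit is the inverse of the negative of the generator. -/
theorem exists_inverse_of_orbitIntegral (T : C0Semigroup X) {M : ℝ} (hM0 : 0 ≤ M)
    (hM : ∀ τ, 0 ≤ τ → ∀ x, ‖T.orbitIntegral τ x‖ ≤ M * ‖x‖)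
    (hD : ∀ x ∈ T.generatorDomain, ∃ y, Tendsto (fun τ => T.orbitIntegral τ x) atTop (𝓝 y))
    (hdecay : ∀ x ∈ T.generatorDomain, Tendsto (fun τ => T τ x) atTop (𝓝 0)) :
    ∃ R : X →L[ℂ] X, ‖R‖ ≤ M ∧ (∀ x y, T.HasRightDerivZero x y → R y = -x) ∧
      ∀ y, T.HasRightDerivZero (R y) (-y) := by
  choose R hR using T.exists_tendsto_orbitIntegral hM hD
  let L : X →ₗ[ℂ] X :=
    { toFun := R
      map_add' := fun x y => tendsto_nhds_unique (hR (x + y)) (((hR x).add (hR y)).congr' (by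
        filter_upwards [eventually_ge_atTop 0] with τ hτ
        rw [T.orbitIntegral_add hτ]))
      map_smul' := fun c x => tendsto_nhds_unique (hR (c • x)) (((hR x).const_smul c).congr
        fun τ => (T.orbitIntegral_smul τ c x).symm) }
  have hL : ∀ x, ‖L x‖ ≤ M * ‖x‖ := fun x => le_of_tendsto (hR x).norm (by
    filter_upwards [eventually_ge_atTop 0] with τ hτ using hM τ hτ x)
  refine ⟨L.mkContinuous M hL, L.mkContinuous_norm_le hM0 hL, fun x y h => ?_, fun y => ?_⟩
  · refine tendsto_nhds_unique (hR y) ?_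
    have := (hdecay x ⟨y, h⟩).sub_const x
    rw [zero_sub] at this
    refine this.congr' ?_
    filter_upwards [eventually_ge_atTop 0] with τ hτ
    exact (orbitIntegral_of_hasRightDerivZero h hτ).symm
  -- Let `τ → ∞` in `map_orbitIntegral`; the difference quotient of `R y` is then minus an average
  -- of the orbit of `y`.
  · have h1 : ∀ t, 0 ≤ t → T t (R y) = R y - T.orbitIntegral t y := by
      intro t ht
      refine tendsto_nhds_unique (((T t).continuous.tendsto _).comp (hR y)) ?_
      refine (((hR y).comp (tendsto_atTop_add_const_right _ t tendsto_id)).sub_const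
        (T.orbitIntegral t y)).congr' ?_
      filter_upwards [eventually_ge_atTop 0] with τ hτ
      exact (T.map_orbitIntegral ht hτ y).symm
    refine (T.tendsto_smul_orbitIntegral y).neg.congr' ?_
    filter_upwards [self_mem_nhdsWithin] with t ht
    change _ = t⁻¹ • (T t (R y) - R y)
    rw [h1 t (le_of_lt ht), ← smul_neg]
    congr 1
    abel

/-- A bound on the truncated Laplace transforms of a semigroup, uniform in the truncation and in
the imaginary part, puts the open right half-plane into the resolvent set and bounds the
resolvent. -/
theorem exists_isResolventAt_of_norm_orbitIntegral_le (T : C0Semigroup X) {B : ℝ → ℝ}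
    (hB0 : ∀ σ, 0 < σ → 0 ≤ B σ)
    (hB : ∀ z : ℂ, 0 < z.re → ∀ τ, 0 ≤ τ → ∀ x,
      ‖(T.rescale z).orbitIntegral τ x‖ ≤ B z.re * ‖x‖) {z : ℂ} (hz : 0 < z.re) :
    ∃ R : X →L[ℂ] X, UnboundedOperator.IsResolventAt T.generator z R ∧ ‖R‖ ≤ B z.re := by
  have hdec : ∀ x ∈ (T.rescale z).generatorDomain, ∃ K, ∀ t, 0 ≤ t →
      ‖T.rescale z t x‖ ≤ K * Real.exp (-(z.re / 2) * t) := by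
    rintro x ⟨y, hy⟩
    have hyT : T.HasRightDerivZero x (y + z • x) := by
      rwa [← T.hasRightDerivZero_rescale_iff z, add_sub_cancel_right]
    -- The hypothesis at `z / 2` bounds `e^{-zt/2} T(t)x` for `x` in the domain, because this orbit
    -- minus `x` is an orbit integral. The other factor `e^{-zt/2}` supplies the decay.
    have hhalf : (0 : ℝ) < (z / 2).re := by simpa using hz
    have h2 := (T.hasRightDerivZero_rescale_iff (z / 2)).2 hyT
    refine ⟨‖x‖ + B (z / 2).re * ‖y + z • x - (z / 2) • x‖, fun t ht => ?_⟩
    have h3 : ‖T.rescale (z / 2) t x‖ ≤ ‖x‖ + B (z / 2).re * ‖y + z • x - (z / 2) • x‖ := by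
      have h4 := hB (z / 2) hhalf t ht (y + z • x - (z / 2) • x)
      rw [orbitIntegral_of_hasRightDerivZero h2 ht] at h4
      linarith [norm_sub_norm_le (T.rescale (z / 2) t x) x]
    calc ‖T.rescale z t x‖ = ‖T.rescale (z / 2) t x‖ * Real.exp (-(z.re / 2) * t) := by
          rw [norm_rescale_apply, norm_rescale_apply, mul_right_comm, ← Real.exp_add]
          congr 2
          simp
          ring
      _ ≤ _ := by gcongr
  have hneg : -(z.re / 2) < 0 := by linarith
  obtain ⟨R, hRn, hR1, hR2⟩ := (T.rescale z).exists_inverse_of_orbitIntegral (hB0 _ hz) (hB z hz)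
    (fun x hx => by
      obtain ⟨K, hK⟩ := hdec x hx
      refine ⟨_, intervalIntegral_tendsto_integral_Ioi 0 ?_ tendsto_id⟩
      refine ((integrableOn_exp_mul_Ioi hneg 0).const_mul K).mono' ?_ ?_
      · exact ((((T.rescale z).continuousOn' x).mono Set.Ioi_subset_Ici_self).aestronglyMeasurable
          measurableSet_Ioi)
      · filter_upwards [ae_restrict_mem measurableSet_Ioi] with t ht using hK t (le_of_lt ht))
    (fun x hx => by
      obtain ⟨K, hK⟩ := hdec x hx
      refine squeeze_zero_norm' (a := fun t => K * Real.exp (-(z.re / 2) * t)) ?_ ?_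
      · filter_upwards [eventually_ge_atTop 0] with t ht using hK t ht
      · have := (Real.tendsto_exp_atBot.comp
          (tendsto_id.const_mul_atTop_of_neg hneg)).const_mul K
        simpa using this)
  refine ⟨R, ⟨fun x => ?_, fun y => ?_⟩, hRn⟩
  · have := hR1 _ _ ((T.hasRightDerivZero_rescale_iff z).2 (T.generator_spec x))
    rw [← neg_sub, map_neg, this, neg_neg]
  · have : T.HasRightDerivZero (R y) (z • R y - y) := by
      rw [← T.hasRightDerivZero_rescale_iff z, sub_sub_cancel_left]
      exact hR2 y
    refine ⟨⟨_, this⟩, ?_⟩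
    rw [this.generator_eq, sub_sub_cancel]

end Complete

/-! ### The excess functional and its uniform bound -/

theorem continuousOn_pairing (T : C0Semigroup X) (x : X) (x' : StrongDual ℂ X) :
    ContinuousOn (fun t => x' (T t x)) (Set.Ioi 0) :=
  x'.continuous.comp_continuousOn ((T.continuousOn' x).mono Set.Ioi_subset_Ici_self)

/-- The integral over `(0, ∞)` of the excess of `|⟨x', T(t)x⟩|` over the threshold `δ`. -/
noncomputable def excess (T : C0Semigroup X) (δ : ENNReal) (x : X) (x' : StrongDual ℂ X) :
    ENNReal :=
  ∫⁻ t in Set.Ioi (0 : ℝ), (‖x' (T t x)‖ₑ - δ)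

theorem aemeasurable_enorm_pairing_sub (T : C0Semigroup X) (δ : ENNReal) (x : X)
    (x' : StrongDual ℂ X) :
    AEMeasurable (fun t => ‖x' (T t x)‖ₑ - δ) (volume.restrict (Set.Ioi (0 : ℝ))) :=
  ((T.continuousOn_pairing x x').aemeasurable measurableSet_Ioi).enorm.sub_const δ

/-- Fatou's lemma: the excess is lower semicontinuous jointly in both arguments. -/
theorem isClosed_excess_le (T : C0Semigroup X) {Y : Type*} [NormedAddCommGroup Y]
    [NormedSpace ℂ Y] (ι : Y →L[ℂ] StrongDual ℂ X) (δ c : ENNReal) :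
    IsClosed {q : X × Y | T.excess δ q.1 (ι q.2) ≤ c} := by
  refine IsSeqClosed.isClosed fun u q hu huq => ?_
  have hlim : ∀ t, Tendsto (fun n => ‖(ι (u n).2) (T t (u n).1)‖ₑ - δ) atTop
      (𝓝 (‖(ι q.2) (T t q.1)‖ₑ - δ)) := by
    intro t
    have h1 : Tendsto (fun n => T t (u n).1) atTop (𝓝 (T t q.1)) :=
      (((T t).continuous.comp continuous_fst).tendsto q).comp huq
    have h2 : Tendsto (fun n => ι (u n).2) atTop (𝓝 (ι q.2)) :=
      ((ι.continuous.comp continuous_snd).tendsto q).comp huq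
    exact ENNReal.Tendsto.sub
      ((isBoundedBilinearMap_apply.continuous.tendsto (ι q.2, T t q.1)).comp
        (h2.prodMk_nhds h1)).enorm tendsto_const_nhds
      (Or.inl enorm_ne_top)
  change T.excess δ q.1 (ι q.2) ≤ c
  calc T.excess δ q.1 (ι q.2)
      = ∫⁻ t in Set.Ioi (0 : ℝ),
          liminf (fun n => ‖(ι (u n).2) (T t (u n).1)‖ₑ - δ) atTop :=
        lintegral_congr fun t => (hlim t).liminf_eq.symm
    _ ≤ liminf (fun n => T.excess δ (u n).1 (ι (u n).2)) atTop :=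
        lintegral_liminf_le' fun n => T.aemeasurable_enorm_pairing_sub δ _ _
    _ ≤ c := liminf_le_of_frequently_le' (Frequently.of_forall hu)

theorem enorm_sub_le_of_rpow (s δ : ENNReal) (hδ : δ ≠ 0) (hδ' : δ ≠ ⊤) {p : ℝ} (hp : 1 ≤ p) :
    s - δ ≤ δ ^ (1 - p) * s ^ p := by
  rcases le_total s δ with h | h
  · rw [tsub_eq_zero_of_le h]
    exact zero_le
  · calc s - δ ≤ s := tsub_le_self
      _ = δ ^ (1 - p) * (δ ^ (p - 1) * s) := by
        rw [← mul_assoc, ← ENNReal.rpow_add _ _ hδ hδ']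
        simp
      _ ≤ δ ^ (1 - p) * (s ^ (p - 1) * s) := by
        gcongr
      _ = δ ^ (1 - p) * s ^ p := by
        congr 1
        conv_lhs => rw [← ENNReal.rpow_one s, ← ENNReal.rpow_mul, one_mul]
        rw [← ENNReal.rpow_add_of_nonneg _ _ (by linarith) zero_le_one, sub_add_cancel]

/-- One integer `m` dominates both `p` and the integral, so countably many conditions cover all
exponents, each controlling every `δ ≤ 1` at once. -/
theorem exists_nat_excess_le (T : C0Semigroup X) (x : X) (x' : StrongDual ℂ X) {p : ℝ}
    (hp : 1 ≤ p) (hfin : ∫⁻ t in Set.Ioi (0 : ℝ), ‖x' (T t x)‖ₑ ^ p < ⊤) :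
    ∃ m : ℕ, ∀ δ : ENNReal, δ ≠ 0 → δ ≤ 1 → T.excess δ x x' ≤ m * δ ^ (-(m : ℝ)) := by
  obtain ⟨m₁, hm₁⟩ := ENNReal.exists_nat_gt hfin.ne
  obtain ⟨m₂, hm₂⟩ := exists_nat_gt p
  refine ⟨max m₁ m₂, fun δ h0 h1 => ?_⟩
  have htop : δ ≠ ⊤ := ne_top_of_le_ne_top ENNReal.one_ne_top h1
  have hpow : δ ^ (1 - p) ≠ ⊤ := ENNReal.rpow_ne_top_of_ne_zero h0 htop
  calc T.excess δ x x'
      ≤ ∫⁻ t in Set.Ioi (0 : ℝ), δ ^ (1 - p) * ‖x' (T t x)‖ₑ ^ p :=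
        lintegral_mono fun t => enorm_sub_le_of_rpow _ δ h0 htop hp
    _ = δ ^ (1 - p) * ∫⁻ t in Set.Ioi (0 : ℝ), ‖x' (T t x)‖ₑ ^ p := lintegral_const_mul' _ _ hpow
    _ ≤ δ ^ (-((max m₁ m₂ : ℕ) : ℝ)) * ((max m₁ m₂ : ℕ) : ENNReal) := by
        gcongr ?_ * ?_
        · refine ENNReal.rpow_le_rpow_of_exponent_ge h1 ?_
          have : (m₂ : ℝ) ≤ ((max m₁ m₂ : ℕ) : ℝ) := by exact_mod_cast le_max_right _ _
          linarith
        · exact hm₁.le.trans (by exact_mod_cast le_max_left _ _)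
    _ = _ := mul_comm _ _

/-- Baire's theorem turns individual weak integrability into a uniform bound. -/
theorem exists_excess_bound [CompleteSpace X] (T : C0Semigroup X)
    {Y : Type*} [NormedAddCommGroup Y] [NormedSpace ℂ Y] [CompleteSpace Y]
    (ι : Y →L[ℂ] StrongDual ℂ X)
    (hint : ∀ (x : X) (y : Y), ∃ p : ℝ, 1 ≤ p ∧
      ∫⁻ t in Set.Ioi (0 : ℝ), ‖(ι y) (T t x)‖ₑ ^ p < ⊤) {ε : ENNReal} (hε : ε ≠ 0) :
    ∃ K : ENNReal, K ≠ ⊤ ∧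
      ∀ (x : X) (y : Y), ‖x‖ ≤ 1 → ‖y‖ ≤ 1 → T.excess ε x (ι y) ≤ K := by
  -- All `δ` are built into `F m` because the threshold needed below depends on the radius of the
  -- ball that Baire's theorem provides.
  let F : ℕ → Set (X × Y) := fun m =>
    {q | ∀ δ : ENNReal, δ ≠ 0 → δ ≤ 1 → T.excess δ q.1 (ι q.2) ≤ m * δ ^ (-(m : ℝ))}
  have hFc : ∀ m, IsClosed (F m) := by
    intro m
    simp only [F, Set.ofPred_forall]
    exact isClosed_iInter fun δ => isClosed_iInter fun _ => isClosed_iInter fun _ =>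
      T.isClosed_excess_le ι _ _
  have hFu : ⋃ m, F m = Set.univ := by
    refine Set.eq_univ_of_forall fun q => Set.mem_iUnion.2 ?_
    obtain ⟨p, hp, hfin⟩ := hint q.1 q.2
    exact T.exists_nat_excess_le q.1 (ι q.2) hp hfin
  obtain ⟨m, ⟨x₀, y₀⟩, hq⟩ := nonempty_interior_of_iUnion_of_closed hFc hFu
  obtain ⟨r, hr, hball⟩ := Metric.mem_nhds_iff.1 (mem_interior_iff_mem_nhds.1 hq)
  obtain ⟨c, hc0, hcr⟩ : ∃ c : ℝ, 0 < c ∧ c < r := ⟨r / 2, by positivity, by linarith⟩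
  set a : ENNReal := ENNReal.ofReal (c * c) with ha
  have ha0 : a ≠ 0 := by simp [ha, hc0]
  have hat : a ≠ ⊤ := ENNReal.ofReal_ne_top
  -- Polarization expresses `c² ⟨y, T(t)x⟩` by four pairings with arguments in the ball; four
  -- thresholds `δ` must fit under `c² ε`.
  obtain ⟨δ, hδ0, hδ1, hδ⟩ : ∃ δ : ENNReal, δ ≠ 0 ∧ δ ≤ 1 ∧ δ + δ + δ + δ ≤ a * ε := by
    refine ⟨min 1 (a * ε / 4), ?_, min_le_left _ _, ?_⟩
    · simp [ha0, hε, min_eq_iff]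
    · calc _ ≤ a * ε / 4 + a * ε / 4 + a * ε / 4 + a * ε / 4 := by
            gcongr <;> exact min_le_right _ _
        _ = 4 * (a * ε / 4) := by ring
        _ ≤ a * ε := ENNReal.mul_div_le
  set G : ENNReal := m * δ ^ (-(m : ℝ)) with hG
  have hGt : G ≠ ⊤ := ENNReal.mul_ne_top (ENNReal.natCast_ne_top m)
    (ENNReal.rpow_ne_top_of_ne_zero hδ0 (ne_top_of_le_ne_top ENNReal.one_ne_top hδ1))
  refine ⟨a⁻¹ * (G + G + G + G), ENNReal.mul_ne_top (ENNReal.inv_ne_top.2 ha0) (by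
    simp [hGt]), fun x y hx1 hy1 => ?_⟩
  have hmem : ∀ (u : X) (v : Y), ‖u‖ < r → ‖v‖ < r →
      T.excess δ (x₀ + u) (ι (y₀ + v)) ≤ G := by
    intro u v hu hv
    have : (x₀ + u, y₀ + v) ∈ F m := by
      refine hball ?_
      rw [Metric.mem_ball, Prod.dist_eq, max_lt_iff, dist_self_add_left, dist_self_add_left]
      exact ⟨hu, hv⟩
    exact this δ hδ0 hδ1
  have hu : ‖(c : ℂ) • x‖ < r := by
    rw [norm_smul, Complex.norm_real, Real.norm_of_nonneg hc0.le]
    nlinarith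
  have hv : ‖(c : ℂ) • y‖ < r := by
    rw [norm_smul, Complex.norm_real, Real.norm_of_nonneg hc0.le]
    nlinarith
  have hz : ‖(0 : X)‖ < r := by simpa using hr
  have hz' : ‖(0 : Y)‖ < r := by simpa using hr
  have h1 := hmem _ _ hu hv
  have h2 := hmem _ _ hu hz'
  have h3 := hmem _ _ hz hv
  have h4 := hmem _ _ hz hz'
  have hpt : ∀ t, ‖(ι y) (T t x)‖ₑ - ε ≤ a⁻¹ *
      ((‖(ι (y₀ + (c : ℂ) • y)) (T t (x₀ + (c : ℂ) • x))‖ₑ - δ) +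
        (‖(ι (y₀ + 0)) (T t (x₀ + (c : ℂ) • x))‖ₑ - δ) +
        (‖(ι (y₀ + (c : ℂ) • y)) (T t (x₀ + 0))‖ₑ - δ) + (‖(ι (y₀ + 0)) (T t (x₀ + 0))‖ₑ - δ)) := by
    intro t
    set f₁ := (ι (y₀ + (c : ℂ) • y)) (T t (x₀ + (c : ℂ) • x)) with hf₁
    set f₂ := (ι (y₀ + 0)) (T t (x₀ + (c : ℂ) • x)) with hf₂
    set f₃ := (ι (y₀ + (c : ℂ) • y)) (T t (x₀ + 0)) with hf₃
    set f₄ := (ι (y₀ + 0)) (T t (x₀ + 0)) with hf₄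
    have hpol : ((c * c : ℝ) : ℂ) * (ι y) (T t x) = f₁ - f₂ - f₃ + f₄ := by
      have hadd : ∀ w, (ι (y₀ + (c : ℂ) • y)) w = (ι y₀) w + c * (ι y) w := fun w => by
        rw [map_add, map_smul]; rfl
      simp only [hf₁, hf₂, hf₃, hf₄, hadd, add_zero]
      simp only [map_add, map_smul, smul_eq_mul]
      push_cast
      ring
    have hnorm : a * ‖(ι y) (T t x)‖ₑ ≤ ‖f₁‖ₑ + ‖f₂‖ₑ + ‖f₃‖ₑ + ‖f₄‖ₑ := by
      have haa : a = ‖((c * c : ℝ) : ℂ)‖ₑ := by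
        rw [← ofReal_norm, Complex.norm_real, Real.norm_of_nonneg (by positivity)]
      rw [haa, ← enorm_mul, hpol]
      refine (enorm_add_le _ _).trans ?_
      gcongr
      refine enorm_sub_le.trans ?_
      gcongr
      exact enorm_sub_le
    rw [tsub_le_iff_right]
    have h5 : a * ‖(ι y) (T t x)‖ₑ ≤
        ((‖f₁‖ₑ - δ) + (‖f₂‖ₑ - δ) + (‖f₃‖ₑ - δ) + (‖f₄‖ₑ - δ)) + a * ε := by
      calc _ ≤ ‖f₁‖ₑ + ‖f₂‖ₑ + ‖f₃‖ₑ + ‖f₄‖ₑ := hnorm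
        _ ≤ ((‖f₁‖ₑ - δ) + δ) + ((‖f₂‖ₑ - δ) + δ) + ((‖f₃‖ₑ - δ) + δ) + ((‖f₄‖ₑ - δ) + δ) := by
          gcongr <;> exact le_tsub_add
        _ = ((‖f₁‖ₑ - δ) + (‖f₂‖ₑ - δ) + (‖f₃‖ₑ - δ) + (‖f₄‖ₑ - δ)) + (δ + δ + δ + δ) := by ring
        _ ≤ _ := by gcongr
    calc ‖(ι y) (T t x)‖ₑ = a⁻¹ * (a * ‖(ι y) (T t x)‖ₑ) := by
          rw [← mul_assoc, ENNReal.inv_mul_cancel ha0 hat, one_mul]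
      _ ≤ a⁻¹ * (((‖f₁‖ₑ - δ) + (‖f₂‖ₑ - δ) + (‖f₃‖ₑ - δ) + (‖f₄‖ₑ - δ)) + a * ε) := by gcongr
      _ = _ := by rw [mul_add, ← mul_assoc a⁻¹ a, ENNReal.inv_mul_cancel ha0 hat, one_mul]
  have hm := fun u v => T.aemeasurable_enorm_pairing_sub δ u v
  calc T.excess ε x (ι y) ≤ _ := lintegral_mono hpt
    _ = a⁻¹ * (T.excess δ _ _ + T.excess δ _ _ + T.excess δ _ _ + T.excess δ _ _) := by
        rw [lintegral_const_mul' _ _ (ENNReal.inv_ne_top.2 ha0),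
          lintegral_add_right' _ (hm _ _), lintegral_add_right' _ (hm _ _),
          lintegral_add_right' _ (hm _ _)]
        rfl
    _ ≤ _ := by gcongr

theorem exists_excess_bound_of_isClosed [CompleteSpace X] (T : C0Semigroup X)
    (E : Submodule ℂ (StrongDual ℂ X)) (hE : IsClosed (E : Set (StrongDual ℂ X)))
    (hint : ∀ x : X, ∀ x' ∈ E, ∃ p : ℝ, 1 ≤ p ∧
      ∫⁻ t in Set.Ioi (0 : ℝ), ‖x' (T t x)‖ₑ ^ p < ⊤) {ε : ENNReal} (hε : ε ≠ 0) :
    ∃ K : ENNReal, K ≠ ⊤ ∧ ∀ x : X, ∀ x' ∈ E, ‖x‖ ≤ 1 → ‖x'‖ ≤ 1 → T.excess ε x x' ≤ K := by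
  have : CompleteSpace E := hE.completeSpace_coe
  obtain ⟨K, hK, h⟩ := T.exists_excess_bound (Y := E) E.subtypeL (fun x y => by
    obtain ⟨p, hp, hfin⟩ := hint x y.1 y.2
    refine ⟨p, hp, ?_⟩
    rwa [Submodule.subtypeL_apply]) hε
  exact ⟨K, hK, fun x x' hx' hx hx'1 => h x ⟨x', hx'⟩ hx hx'1⟩

/-! ### Laplace transform bounds -/

theorem norm_pairing_orbitIntegral_rescale_le [CompleteSpace X] (T : C0Semigroup X)
    {ε K : ℝ} (hε : 0 ≤ ε) (hK : 0 ≤ K) {x : X} {x' : StrongDual ℂ X}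
    (h : T.excess (ENNReal.ofReal ε) x x' ≤ ENNReal.ofReal K) {z : ℂ} (hz : 0 < z.re)
    {τ : ℝ} (hτ : 0 ≤ τ) : ‖x' ((T.rescale z).orbitIntegral τ x)‖ ≤ K + ε / z.re := by
  have hexp : ∫⁻ t in Set.Ioi (0 : ℝ), ENNReal.ofReal (Real.exp (-z.re * t)) =
      ENNReal.ofReal (1 / z.re) := by
    rw [← ofReal_integral_eq_lintegral_ofReal
      (integrableOn_exp_mul_Ioi (by linarith) 0) (ae_of_all _ fun t => (Real.exp_pos _).le),
      integral_exp_mul_Ioi (by linarith)]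
    simp
  rw [orbitIntegral, ← x'.intervalIntegral_comp_comm
    ((T.rescale z).intervalIntegrable_orbit x le_rfl hτ), intervalIntegral.integral_of_le hτ]
  rw [← ENNReal.ofReal_le_ofReal_iff (by positivity), ofReal_norm]
  calc _ ≤ ∫⁻ t in Set.Ioc 0 τ, ‖x' (T.rescale z t x)‖ₑ := enorm_integral_le_lintegral_enorm _
    _ ≤ ∫⁻ t in Set.Ioi (0 : ℝ), ‖x' (T.rescale z t x)‖ₑ :=
        lintegral_mono_set Set.Ioc_subset_Ioi_self
    _ ≤ ∫⁻ t in Set.Ioi (0 : ℝ), ((‖x' (T t x)‖ₑ - ENNReal.ofReal ε) +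
          ENNReal.ofReal ε * ENNReal.ofReal (Real.exp (-z.re * t))) := by
        refine setLIntegral_mono' measurableSet_Ioi fun t ht => ?_
        have h1 : ENNReal.ofReal (Real.exp (-z.re * t)) ≤ 1 := by
          rw [← ENNReal.ofReal_one]
          refine ENNReal.ofReal_le_ofReal (Real.exp_le_one_iff.2 ?_)
          have : 0 < z.re * t := mul_pos hz ht
          linarith
        have h2 : ‖x' (T.rescale z t x)‖ₑ =
            ENNReal.ofReal (Real.exp (-z.re * t)) * ‖x' (T t x)‖ₑ := by
          rw [rescale_apply, map_smul, enorm_smul, ← ofReal_norm, Complex.norm_exp]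
          simp
        rw [h2]
        -- The exponential is dropped on the integrable excess and kept on the constant `ε`, where
        -- it integrates to `1 / Re z`.
        calc _ ≤ ENNReal.ofReal (Real.exp (-z.re * t)) *
              ((‖x' (T t x)‖ₑ - ENNReal.ofReal ε) + ENNReal.ofReal ε) := by
                gcongr
                exact le_tsub_add
          _ = ENNReal.ofReal (Real.exp (-z.re * t)) * (‖x' (T t x)‖ₑ - ENNReal.ofReal ε) +
              ENNReal.ofReal ε * ENNReal.ofReal (Real.exp (-z.re * t)) := by ring
          _ ≤ 1 * (‖x' (T t x)‖ₑ - ENNReal.ofReal ε) +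
              ENNReal.ofReal ε * ENNReal.ofReal (Real.exp (-z.re * t)) := by gcongr
          _ = _ := by rw [one_mul]
    _ = T.excess (ENNReal.ofReal ε) x x' + ENNReal.ofReal ε * ENNReal.ofReal (1 / z.re) := by
        rw [lintegral_add_left' (T.aemeasurable_enorm_pairing_sub _ _ _),
          lintegral_const_mul' _ _ ENNReal.ofReal_ne_top, hexp]
        rfl
    _ ≤ ENNReal.ofReal K + ENNReal.ofReal ε * ENNReal.ofReal (1 / z.re) := by gcongr
    _ = ENNReal.ofReal (K + ε / z.re) := by
        rw [← ENNReal.ofReal_mul hε, ← ENNReal.ofReal_add hK (by positivity), mul_one_div]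

theorem norm_orbitIntegral_rescale_le [CompleteSpace X] (T : C0Semigroup X)
    {E : Submodule ℂ (StrongDual ℂ X)} {C ε K : ℝ} (hC : 0 < C)
    (hE : ∀ x : X,
      ‖x‖ ≤ sSup ((fun x' : StrongDual ℂ X => C * ‖x' x‖) '' {x' | x' ∈ E ∧ ‖x'‖ ≤ 1}))
    (hε : 0 ≤ ε) (hK : 0 ≤ K)
    (h : ∀ x : X, ∀ x' ∈ E, ‖x‖ ≤ 1 → ‖x'‖ ≤ 1 →
      T.excess (ENNReal.ofReal ε) x x' ≤ ENNReal.ofReal K)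
    {z : ℂ} (hz : 0 < z.re) {τ : ℝ} (hτ : 0 ≤ τ) (x : X) :
    ‖(T.rescale z).orbitIntegral τ x‖ ≤ C * (K + ε / z.re) * ‖x‖ := by
  have hunit : ∀ u : X, ‖u‖ ≤ 1 → ‖(T.rescale z).orbitIntegral τ u‖ ≤ C * (K + ε / z.re) := by
    intro u hu
    refine (hE _).trans (csSup_le ⟨_, 0, ⟨E.zero_mem, by simp⟩, rfl⟩ ?_)
    rintro _ ⟨x', ⟨hx', hx'1⟩, rfl⟩
    have := T.norm_pairing_orbitIntegral_rescale_le hε hK (h u x' hx' hu hx'1) hz hτ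
    exact mul_le_mul_of_nonneg_left this hC.le
  rcases eq_or_ne x 0 with rfl | hx
  · have := (T.rescale z).orbitIntegral_smul τ 0 (0 : X)
    rw [zero_smul, zero_smul] at this
    simp [this]
  · have hx0 : ‖x‖ ≠ 0 := norm_ne_zero_iff.2 hx
    have h1 := hunit (((‖x‖⁻¹ : ℝ) : ℂ) • x) (by
      rw [norm_smul, Complex.norm_real, norm_inv, norm_norm, inv_mul_cancel₀ hx0])
    rw [orbitIntegral_smul, norm_smul, Complex.norm_real, norm_inv, norm_norm,
      inv_mul_le_iff₀ (by positivity)] at h1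
    linarith

end C0Semigroup

/-! ### Neumann series and crossing the imaginary axis -/

namespace UnboundedOperator

variable {X : Type*} [NormedAddCommGroup X] [NormedSpace ℂ X]

/-- Neumann series perturbation of the resolvent. -/
theorem IsResolventAt.exists_of_norm_sub_mul_le [CompleteSpace X] {A : X →ₗ.[ℂ] X}
    {w z : ℂ} {R : X →L[ℂ] X}
    (hR : IsResolventAt A w R) (h : ‖w - z‖ * ‖R‖ ≤ 1 / 2) :
    ∃ S : X →L[ℂ] X, IsResolventAt A z S ∧ ‖S‖ ≤ 2 * ‖R‖ := by
  have hP : ‖(w - z) • R‖ ≤ 1 / 2 := by rwa [norm_smul]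
  let U := Units.oneSub ((w - z) • R) (hP.trans_lt (by norm_num))
  let V : X →L[ℂ] X := ↑U⁻¹
  have hVU : ∀ y, V (y - (w - z) • R y) = y := fun y => by
    have := congrArg (fun Q : X →L[ℂ] X => Q y) U.inv_mul
    exact this
  have hUV : ∀ y, V y - (w - z) • R (V y) = y := fun y => by
    have := congrArg (fun Q : X →L[ℂ] X => Q y) U.mul_inv
    exact this
  refine ⟨R.comp V, ⟨fun x => ?_, fun y => ?_⟩, ?_⟩
  · have h1 := hR.1 x
    have h2 := hVU (w • (x : X) - A x)
    rw [h1] at h2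
    have h3 : z • (x : X) - A x = w • (x : X) - A x - (w - z) • (x : X) := by
      rw [sub_smul]; abel
    rw [ContinuousLinearMap.comp_apply, h3, h2, h1]
  · obtain ⟨hd, he⟩ := hR.2 (V y)
    refine ⟨hd, ?_⟩
    calc z • R (V y) - A ⟨R (V y), hd⟩
        = w • R (V y) - A ⟨R (V y), hd⟩ - (w - z) • R (V y) := by rw [sub_smul]; abel
      _ = y := by rw [he, hUV]
  · refine ContinuousLinearMap.opNorm_le_bound _ (by positivity) fun y => ?_
    have h1 : ‖V y‖ ≤ 2 * ‖y‖ := by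
      have h2 : ‖(w - z) • R (V y)‖ ≤ 1 / 2 * ‖V y‖ :=
        (((w - z) • R).le_opNorm (V y)).trans (by gcongr)
      have h3 : ‖V y‖ ≤ ‖y‖ + ‖(w - z) • R (V y)‖ := by
        conv_lhs => rw [← sub_add_cancel (V y) ((w - z) • R (V y)), hUV]
        exact norm_add_le _ _
      linarith
    calc ‖R (V y)‖ ≤ ‖R‖ * ‖V y‖ := R.le_opNorm _
      _ ≤ ‖R‖ * (2 * ‖y‖) := by gcongr
      _ = 2 * ‖R‖ * ‖y‖ := by ring

theorem abscissaUniformBoundedness_le {A : X →ₗ.[ℂ] X} {s M : ℝ}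
    (h : ∀ z : ℂ, s ≤ z.re → ∃ R : X →L[ℂ] X, IsResolventAt A z R ∧ ‖R‖ ≤ M) :
    abscissaUniformBoundedness A ≤ s := by
  refine sInf_le ⟨s, ⟨fun z hz => ?_, M, fun z hz => ?_⟩, rfl⟩
  · obtain ⟨R, hR, -⟩ := h z hz
    exact ⟨R, hR⟩
  · obtain ⟨R, hR, hM⟩ := h z hz
    rwa [(isResolventAt_resolvent ⟨R, hR⟩).unique hR]

end UnboundedOperator

theorem theorem5p1 {X : Type*} [NormedAddCommGroup X] [NormedSpace ℂ X] [CompleteSpace X]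
    (T : C0Semigroup X) (E : Submodule ℂ (StrongDual ℂ X))
    (hE_closed : IsClosed (E : Set (StrongDual ℂ X))) (hE_norming : IsAlmostNorming E)
    (hint : ∀ x : X, ∀ x' ∈ E, ∃ p : ℝ, 1 ≤ p ∧
      ∫⁻ t in Set.Ioi (0 : ℝ), ‖x' (T t x)‖ₑ ^ p < ⊤) :
    UnboundedOperator.abscissaUniformBoundedness T.generator < 0 := by
  obtain ⟨C, hC, hE⟩ := hE_norming
  -- The order matters: `ε` depends on `C`, then `K` on `ε`, then `σ` on `K`. The two bounds `1 / 8`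
  -- give `‖R‖ ≤ 1 / (4σ)` on `Re z = σ`, so the Neumann series covers distance `2σ` and reaches `Re
  -- z = -σ`.
  obtain ⟨ε, hε, hCε⟩ : ∃ ε : ℝ, 0 < ε ∧ C * ε = 1 / 8 :=
    ⟨1 / (8 * C), by positivity, by field_simp⟩
  obtain ⟨K', hK'top, hK'⟩ := T.exists_excess_bound_of_isClosed E hE_closed hint
    (ε := ENNReal.ofReal ε) (by simpa using hε)
  obtain ⟨K, hK, rfl⟩ : ∃ K : ℝ, 0 ≤ K ∧ ENNReal.ofReal K = K' :=
    ⟨K'.toReal, ENNReal.toReal_nonneg, ENNReal.ofReal_toReal hK'top⟩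
  obtain ⟨σ, hσ, hKσ⟩ : ∃ σ : ℝ, 0 < σ ∧ C * K * σ ≤ 1 / 8 := by
    refine ⟨1 / (8 * (C * K + 1)), by positivity, ?_⟩
    rw [mul_one_div, div_le_div_iff₀ (by positivity) (by norm_num)]
    linarith
  have hres : ∀ z : ℂ, 0 < z.re → ∃ R : X →L[ℂ] X,
      UnboundedOperator.IsResolventAt T.generator z R ∧ ‖R‖ ≤ C * (K + ε / z.re) := fun z hz =>
    T.exists_isResolventAt_of_norm_orbitIntegral_le (B := fun s => C * (K + ε / s))
      (fun s hs => by positivity)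
      (fun w hw τ hτ x => T.norm_orbitIntegral_rescale_le hC hE hε.le hK hK' hw hτ x) hz
  have hBσ : C * (K + ε / σ) ≤ 1 / (4 * σ) := by
    rw [le_div_iff₀ (by positivity)]
    calc C * (K + ε / σ) * (4 * σ) = 4 * (C * K * σ) + 4 * (C * ε) := by field_simp
      _ ≤ 1 := by linarith
  have hle : UnboundedOperator.abscissaUniformBoundedness T.generator ≤ ((-σ : ℝ) : EReal) := by
    refine UnboundedOperator.abscissaUniformBoundedness_le (M := 2 * (1 / (4 * σ))) fun z hz => ?_
    have hpos : 0 < 1 / (4 * σ) := by positivity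
    rcases le_total σ z.re with h | h
    · obtain ⟨R, hR, hRn⟩ := hres z (hσ.trans_le h)
      refine ⟨R, hR, hRn.trans ?_⟩
      have : C * (K + ε / z.re) ≤ C * (K + ε / σ) := by gcongr
      linarith
    -- In the strip `-σ ≤ Re z ≤ σ`, perturb horizontally from the point of the line `Re = σ` with
    -- the same imaginary part.
    · obtain ⟨R, hR, hRn⟩ := hres ⟨σ, z.im⟩ hσ
      have hRn' : ‖R‖ ≤ 1 / (4 * σ) := hRn.trans hBσ
      have hdist : ‖(⟨σ, z.im⟩ : ℂ) - z‖ ≤ 2 * σ := by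
        have : (⟨σ, z.im⟩ : ℂ) - z = ((σ - z.re : ℝ) : ℂ) := by
          apply Complex.ext <;> simp
        rw [this, Complex.norm_real, Real.norm_of_nonneg (by linarith)]
        linarith
      obtain ⟨S, hS, hSn⟩ := hR.exists_of_norm_sub_mul_le (z := z) (by
        calc _ ≤ 2 * σ * (1 / (4 * σ)) := by gcongr
          _ = 1 / 2 := by field_simp; norm_num)
      exact ⟨S, hS, hSn.trans (by gcongr)⟩
  refine hle.trans_lt ?_
  exact_mod_cast neg_lt_zero.2 hσ
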